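/- For $n\ge 2$ let $\mathsf{Ch}_n$ be the Chinese monoid of rank $n$, i.e. the monoid presented by generators $a_1,\dots,a_n$ and relations $a_ja_ka_i=a_ka_ja_i=a_ka_ia_j$ for all $1\le i\le j\le k\le n$, and let $\mathsf{Bcy}=\langle p,q\mid pq=1\rangle$ be the bicyclic monoid. A semigroup $S$ satisfies the semigroup identity $u=v$, where $u,v\in\mathcal A^+$ are nonempty words over an alphabet $\mathcal A$, if $\phi(u)=\phi(v)$ for every semigroup homomorphism $\phi:\mathcal A^+\to S$; a monoid $S$ satisfies an identity $u=v$ between possibly empty words $u,v\in\mathcal A^*$ if $\phi(u)=\phi(v)$ for every monoid homomorphism $\phi:\mathcal A^*\to S$. The semigroup variety generated by $S$ is the smallest class of semigroups that contains $S$ and is closed under isomorphism, homomorphic images, subsemigroups and arbitrary direct products. Then, for every $n\ge 2$, $\mathsf{Ch}_n$ determines the same variety as $\mathsf{Bcy}$: for every alphabet $\mathcal A$ the two monoids satisfy exactly the same semigroup identities $u=v$ with $u,v\in\mathcal A^+$, and exactly the same identities $u=v$ with $u,v\in\mathcal A^*$, and the semigroup varieties that they generate coincide. -/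

import Mathlib

universe u

/-- The defining relations `a_j a_k a_i = a_k a_j a_i = a_k a_i a_j` (`i ≤ j ≤ k`) of the
Chinese monoid of rank `n`, on the generators `a_i`, `i : Fin n`. -/
inductive ChineseRel (n : ℕ) : FreeMonoid (Fin n) → FreeMonoid (Fin n) → Prop
  | left {i j k : Fin n} (hij : i ≤ j) (hjk : j ≤ k) :
      ChineseRel n
        (FreeMonoid.of j * FreeMonoid.of k * FreeMonoid.of i)
        (FreeMonoid.of k * FreeMonoid.of j * FreeMonoid.of i)
  | right {i j k : Fin n} (hij : i ≤ j) (hjk : j ≤ k) :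
      ChineseRel n
        (FreeMonoid.of k * FreeMonoid.of j * FreeMonoid.of i)
        (FreeMonoid.of k * FreeMonoid.of i * FreeMonoid.of j)

/-- The Chinese monoid of rank `n`. -/
abbrev ChineseMonoid (n : ℕ) : Type := PresentedMonoid (ChineseRel n)

/-- The defining relation `p q = 1` of the bicyclic monoid, where `p` is the generator `0`
and `q` is the generator `1`. -/
inductive BicyclicRel : FreeMonoid (Fin 2) → FreeMonoid (Fin 2) → Prop
  | pq : BicyclicRel (FreeMonoid.of 0 * FreeMonoid.of 1) 1

/-- The bicyclic monoid `⟨p, q ∣ p q = 1⟩`. -/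
abbrev BicyclicMonoid : Type := PresentedMonoid BicyclicRel

/-- The semigroup `S` satisfies the semigroup identity `u = v` between (nonempty) words over the
alphabet `A`: `u` and `v` have the same value under every semigroup homomorphism `A⁺ → S`. -/
def SatisfiesSemigroupIdentity (S : Type*) [Semigroup S] {A : Type*} (u v : FreeSemigroup A) :
    Prop :=
  ∀ φ : FreeSemigroup A →ₙ* S, φ u = φ v

/-- The monoid `S` satisfies the identity `u = v` between possibly empty words over the
alphabet `A`, the empty word having the value `1`. -/
def SatisfiesMonoidIdentity (S : Type*) [Monoid S] {A : Type*} (u v : FreeMonoid A) : Prop :=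
  ∀ φ : FreeMonoid A →* S, φ u = φ v

/-- `InSemigroupVariety S T`: the semigroup `T` belongs to the semigroup variety generated by `S`,
that is, to the smallest class of semigroups that contains (every isomorphic copy of) `S` and is
closed under homomorphic images, subsemigroups and arbitrary direct products. -/
inductive InSemigroupVariety (S : Type) [Semigroup S] : (T : Type u) → [Semigroup T] → Prop
  | self {T : Type u} [Semigroup T] (e : S ≃* T) : InSemigroupVariety S T
  | image {T T' : Type u} [Semigroup T] [Semigroup T'] (f : T →ₙ* T')
      (hf : Function.Surjective f) (hT : InSemigroupVariety S T) : InSemigroupVariety S T'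
  | sub {T : Type u} [Semigroup T] (P : Subsemigroup T)
      (hT : InSemigroupVariety S T) : InSemigroupVariety S P
  | prod {ι : Type u} (T : ι → Type u) [∀ i, Semigroup (T i)]
      (hT : ∀ i, InSemigroupVariety S (T i)) : InSemigroupVariety S (∀ i, T i)

/-! Identities pass to homomorphic images and to monoids whose points are separated by homomorphisms
into the given one; varieties behave likewise. For `n ≥ 2` the Chinese monoid maps onto the bicyclic
monoid, so the substance is that homomorphisms into the bicyclic monoid separate its points.
Order-preserving assignments of `q`, `1`, `p` to the generators, cut at `s` and `t`, respect the
Chinese relations (`isChineseFamily_bicyclicStep`). Every element has a canonical form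
(`exists_canonicalForm`). Let `q` and `p` act on `ℕ` as successor and truncated predecessor. For `s
≤ t`, rows with index at least `t` fix `0`, while each earlier row adds its number of letters below
`s` (`chineseAct_canonicalForm`). These counts determine all exponents
(`exponents_eq_of_sum_rowWeight_eq`), which gives separation and, as a by-product, uniqueness of the
form. -/

/-! ### Canonical forms in monoids satisfying the Chinese relations -/

/-- The elements `a i`, `i < n`, satisfy the defining relations of the Chinese monoid. -/
def IsChineseFamily {M : Type*} [Monoid M] (n : ℕ) (a : ℕ → M) : Prop :=
  ∀ i j k, i ≤ j → j ≤ k → k < n →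
    a j * a k * a i = a k * a j * a i ∧ a k * a j * a i = a k * a i * a j

section Canonical

variable {M : Type*} [Monoid M] {n : ℕ} {a : ℕ → M}

/-- The product of the powers `(a m * a i) ^ k i` for `i < j`. -/
def pairProd (a : ℕ → M) (m : ℕ) (k : ℕ → ℕ) : ℕ → M
  | 0 => 1
  | j + 1 => pairProd a m k j * (a m * a j) ^ k j

/-- The `m`-th row of a canonical form. -/
def canonicalRow (a : ℕ → M) (m : ℕ) (k : ℕ → ℕ) : M :=
  pairProd a m k m * a m ^ k m

/-- The canonical form with exponents `k j i`, restricted to the rows `j < m`. -/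
def canonicalForm (a : ℕ → M) (k : ℕ → ℕ → ℕ) : ℕ → M
  | 0 => 1
  | m + 1 => canonicalForm a k m * canonicalRow a m (k m)

theorem pairProd_congr {m : ℕ} {k k' : ℕ → ℕ} :
    ∀ {j : ℕ}, (∀ i < j, k i = k' i) → pairProd a m k j = pairProd a m k' j
  | 0, _ => rfl
  | j + 1, h => by
    rw [pairProd, pairProd, pairProd_congr fun i hi => h i (by omega), h j (by omega)]

theorem canonicalRow_congr {m : ℕ} {k k' : ℕ → ℕ} (h : ∀ i ≤ m, k i = k' i) :
    canonicalRow a m k = canonicalRow a m k' := by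
  rw [canonicalRow, canonicalRow, pairProd_congr fun i hi => h i hi.le, h m le_rfl]

theorem canonicalForm_congr {k k' : ℕ → ℕ → ℕ} :
    ∀ {m : ℕ}, (∀ j < m, ∀ i ≤ j, k j i = k' j i) → canonicalForm a k m = canonicalForm a k' m
  | 0, _ => rfl
  | m + 1, h => by
    rw [canonicalForm, canonicalForm, canonicalForm_congr fun j hj => h j (by omega),
      canonicalRow_congr (h m (by omega))]

theorem IsChineseFamily.commute_pair (ha : IsChineseFamily n a) {i j k : ℕ} (hij : i ≤ j)
    (hjk : j ≤ k) (hk : k < n) : Commute (a j) (a k * a i) := by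
  obtain ⟨h1, h2⟩ := ha i j k hij hjk hk
  rw [Commute, SemiconjBy, ← mul_assoc, h1, h2]

theorem IsChineseFamily.commute_pair_pair (ha : IsChineseFamily n a) {i j k : ℕ} (hik : i ≤ k)
    (hjk : j ≤ k) (hk : k < n) : Commute (a k * a i) (a k * a j) := by
  rcases le_total i j with h | h
  · exact (((ha.commute_pair hik le_rfl hk).mul_left (ha.commute_pair h hjk hk))).symm
  · exact ((ha.commute_pair hjk le_rfl hk).mul_left (ha.commute_pair h hik hk))

/-- Only factors with nonzero exponent matter: a generator need not commute with pairs whose second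
index exceeds its own. -/
theorem commute_pairProd {m : ℕ} {k : ℕ → ℕ} {x : M} :
    ∀ {j : ℕ}, (∀ i < j, k i ≠ 0 → Commute x (a m * a i)) → Commute x (pairProd a m k j)
  | 0, _ => Commute.one_right x
  | j + 1, h => by
    refine (commute_pairProd fun i hi => h i (by omega)).mul_right ?_
    by_cases hk : k j = 0
    · rw [hk, pow_zero]
      exact Commute.one_right x
    · exact (h j (by omega) hk).pow_right _

theorem IsChineseFamily.pairProd_add_single (ha : IsChineseFamily n a) {m i : ℕ} (k : ℕ → ℕ)
    (hm : m < n) : ∀ {j : ℕ}, i < j → j ≤ m →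
      pairProd a m (k + Pi.single i 1) j = pairProd a m k j * (a m * a i)
  | 0, h, _ => absurd h (Nat.not_lt_zero i)
  | j + 1, h, hj => by
    rw [pairProd, pairProd]
    rcases Nat.lt_succ_iff_lt_or_eq.1 h with hij | rfl
    · have hc : Commute (a m * a i) ((a m * a j) ^ k j) :=
        (ha.commute_pair_pair (by omega) (by omega) hm).pow_right _
      rw [ha.pairProd_add_single k hm hij (by omega), mul_assoc]
      simp only [Pi.add_apply, Pi.single_eq_of_ne hij.ne', add_zero]
      rw [hc.eq, mul_assoc]
    · rw [pairProd_congr (k := k + Pi.single i 1) (k' := k) fun l hl => by simp [hl.ne]]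
      simp [pow_succ, mul_assoc]

/-- Multiplying a row by a smaller generator gives a row, preceded by at most one generator. -/
theorem IsChineseFamily.canonicalRow_mul (ha : IsChineseFamily n a) {m i : ℕ} (hm : m < n)
    (hi : i < m) (k : ℕ → ℕ) :
    ∃ k' : ℕ → ℕ, canonicalRow a m k * a i = canonicalRow a m k' ∨
      ∃ l < m, canonicalRow a m k * a i = a l * canonicalRow a m k' := by
  by_cases hd : k m = 0
  · by_cases hl : ∃ l, (i < l ∧ l < m) ∧ k l ≠ 0
    · obtain ⟨l, ⟨⟨hil, hlm⟩, hkl⟩, hmax⟩ :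
          ∃ l, ((i < l ∧ l < m) ∧ k l ≠ 0) ∧ ∀ l', l < l' → l' < m → k l' = 0 := by
        classical
        obtain ⟨l₀, hl₀⟩ := hl
        let P : ℕ → Prop := fun l => (i < l ∧ l < m) ∧ k l ≠ 0
        refine ⟨Nat.findGreatest P m, Nat.findGreatest_spec (P := P) hl₀.1.2.le hl₀,
          fun l' h1 h2 => ?_⟩
        have h3 : i < Nat.findGreatest P m :=
          (Nat.findGreatest_spec (P := P) hl₀.1.2.le hl₀).1.1
        by_contra h4
        exact Nat.findGreatest_is_greatest h1 h2.le ⟨⟨h3.trans h1, h2⟩, h4⟩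
      obtain ⟨k₀, rfl⟩ : ∃ k₀ : ℕ → ℕ, k = k₀ + Pi.single l 1 := by
        refine ⟨k - Pi.single l 1, funext fun x => ?_⟩
        by_cases hx : x = l
        · subst hx
          simp only [Pi.add_apply, Pi.sub_apply, Pi.single_eq_same]
          omega
        · simp [hx]
      -- By maximality of `l`, one pair `a m * a l` can be taken last; `a m * a l * a i = a m * a i
      -- * a l`, and the freed `a l` commutes to the front.
      refine ⟨k₀ + Pi.single i 1, Or.inr ⟨l, hlm, ?_⟩⟩
      have hk₀ : ∀ l', l < l' → l' < m → k₀ l' = 0 := fun l' h1 h2 => by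
        simpa [h1.ne'] using hmax l' h1 h2
      have hd₀ : k₀ m = 0 := by simpa [hlm.ne'] using hd
      have hc : Commute (a l) (pairProd a m (k₀ + Pi.single i 1) m) := by
        refine commute_pairProd fun i' hi' hne => ha.commute_pair ?_ hlm.le hm
        by_contra hlt
        apply hne
        have h1 : i' ≠ i := by omega
        simpa [h1] using hk₀ i' (by omega) hi'
      rw [canonicalRow, canonicalRow, hd]
      simp only [Pi.add_apply, hd₀, Pi.single_eq_of_ne hi.ne', add_zero, pow_zero, mul_one]
      rw [hc.eq, ha.pairProd_add_single k₀ hm hlm le_rfl, ha.pairProd_add_single k₀ hm hi le_rfl,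
        mul_assoc _ _ (a i), mul_assoc _ _ (a l), (ha i l m hil.le hlm.le hm).2]
    · push Not at hl
      refine ⟨k, Or.inr ⟨i, hi, ?_⟩⟩
      have hc : Commute (a i) (pairProd a m k m) := by
        refine commute_pairProd fun i' hi' hne => ha.commute_pair ?_ hi.le hm
        by_contra hlt
        exact hne (hl i' ⟨by omega, hi'⟩)
      rw [canonicalRow, hd, pow_zero, mul_one, hc.eq]
  · obtain ⟨d, hd⟩ := Nat.exists_eq_succ_of_ne_zero hd
    -- One trailing `a m` pairs with `a i`, and the new pair commutes past the remaining `a m ^ d`.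
    refine ⟨Function.update (k + Pi.single i 1) m d, Or.inl ?_⟩
    have hc : Commute (a m ^ d) (a m * a i) :=
      (ha.commute_pair hi.le le_rfl hm).pow_left _
    rw [canonicalRow, canonicalRow,
      pairProd_congr (k := Function.update (k + Pi.single i 1) m d) (k' := k + Pi.single i 1)
        fun l hl => Function.update_of_ne hl.ne _ _,
      ha.pairProd_add_single k hm hi le_rfl, hd, Function.update_self,
      Nat.succ_eq_add_one, pow_succ, mul_assoc, mul_assoc (a m ^ d), hc.eq]
    simp only [mul_assoc]

/-- A generator expelled from row `m` has index below `m`, so the preceding rows absorb it by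
induction; `a m` itself just raises the diagonal exponent. -/
theorem IsChineseFamily.canonicalForm_mul (ha : IsChineseFamily n a) :
    ∀ {m : ℕ}, m ≤ n → ∀ (k : ℕ → ℕ → ℕ) {i : ℕ}, i < m →
      ∃ k' : ℕ → ℕ → ℕ, canonicalForm a k m * a i = canonicalForm a k' m
  | 0, _, _, i, hi => absurd hi (Nat.not_lt_zero i)
  | m + 1, hm, k, i, hi => by
    have key : ∀ (k₁ : ℕ → ℕ → ℕ) (r : ℕ → ℕ), canonicalForm a k₁ m * canonicalRow a m r =
        canonicalForm a (Function.update k₁ m r) (m + 1) := fun k₁ r => by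
      rw [canonicalForm, Function.update_self,
        canonicalForm_congr (k := Function.update k₁ m r) (k' := k₁)
          fun j hj l _ => by rw [Function.update_of_ne hj.ne]]
    rw [canonicalForm, mul_assoc]
    rcases Nat.lt_succ_iff_lt_or_eq.1 hi with him | rfl
    · obtain ⟨r, hr | ⟨l, hl, hr⟩⟩ := ha.canonicalRow_mul hm him (k m)
      · exact ⟨_, by rw [hr, key]⟩
      · obtain ⟨k₁, hk₁⟩ := ha.canonicalForm_mul (by omega) k hl
        exact ⟨_, by rw [hr, ← mul_assoc, hk₁, key]⟩
    · refine ⟨Function.update k i (k i + Pi.single i 1), ?_⟩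
      rw [← key, canonicalRow, canonicalRow, mul_assoc, ← pow_succ,
        pairProd_congr (k := k i + Pi.single i 1) (k' := k i) fun l hl => by simp [hl.ne]]
      simp

end Canonical

/-! ### The canonical generators and existence of canonical forms -/

/-- The generators of the Chinese monoid, indexed by natural numbers. -/
def chineseGen (n i : ℕ) : ChineseMonoid n :=
  if h : i < n then PresentedMonoid.of (ChineseRel n) ⟨i, h⟩ else 1

theorem isChineseFamily_chineseGen (n : ℕ) : IsChineseFamily n (chineseGen n) := by
  intro i j k hij hjk hk
  have hj : j < n := by omega
  have hi : i < n := by omega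
  simp only [chineseGen, hi, hj, hk, dif_pos]
  exact ⟨PresentedMonoid.mk_eq_mk_of_rel
      (ChineseRel.left (i := ⟨i, hi⟩) (j := ⟨j, hj⟩) (k := ⟨k, hk⟩) hij hjk),
    PresentedMonoid.mk_eq_mk_of_rel
      (ChineseRel.right (i := ⟨i, hi⟩) (j := ⟨j, hj⟩) (k := ⟨k, hk⟩) hij hjk)⟩

theorem exists_canonicalForm {n : ℕ} (x : ChineseMonoid n) :
    ∃ k : ℕ → ℕ → ℕ, x = canonicalForm (chineseGen n) k n := by
  have hx : x ∈ Submonoid.closure (Set.range (PresentedMonoid.of (ChineseRel n))) := by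
    rw [PresentedMonoid.closure_range_of]
    trivial
  induction hx using Submonoid.closure_induction_right with
  | one =>
    refine ⟨0, ?_⟩
    have h : ∀ m, canonicalForm (chineseGen n) 0 m = 1 := fun m => by
      induction m with
      | zero => rfl
      | succ m ih =>
        have h' : ∀ j, pairProd (chineseGen n) m 0 j = 1 := fun j => by
          induction j with
          | zero => rfl
          | succ j ih => simp [pairProd, ih]
        simp [canonicalForm, ih, canonicalRow, h']
    exact (h n).symm
  | mul_right x _ y hy ih =>
    obtain ⟨k, rfl⟩ := ih
    obtain ⟨i, rfl⟩ := hy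
    have hi : PresentedMonoid.of (ChineseRel n) i = chineseGen n i := by
      simp [chineseGen]
    rw [hi]
    exact (isChineseFamily_chineseGen n).canonicalForm_mul le_rfl k i.2

/-! ### Homomorphisms from the Chinese monoid to the bicyclic monoid -/

/-- The generator `p` of the bicyclic monoid. -/
def bicyclicP : BicyclicMonoid := PresentedMonoid.of BicyclicRel 0

/-- The generator `q` of the bicyclic monoid. -/
def bicyclicQ : BicyclicMonoid := PresentedMonoid.of BicyclicRel 1

theorem bicyclicP_mul_bicyclicQ : bicyclicP * bicyclicQ = 1 :=
  PresentedMonoid.mk_eq_mk_of_rel BicyclicRel.pq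

/-- The image of the `i`-th generator under `chineseToBicyclic n s t`. -/
def bicyclicStep (s t i : ℕ) : BicyclicMonoid :=
  if i < s then bicyclicQ else if i < t then 1 else bicyclicP

/-- Along `i ≤ j ≤ k` the values run through `q`, `1`, `p` in this order. If `p` and `q` both occur,
then `k` gives `p` and `i` gives `q`, and `p * q = 1` settles the case; otherwise all three values
commute. -/
theorem isChineseFamily_bicyclicStep (n s t : ℕ) : IsChineseFamily n (bicyclicStep s t) := by
  intro i j k hij hjk _
  have hpq := bicyclicP_mul_bicyclicQ
  unfold bicyclicStep
  split_ifs <;> first | omega | simp [mul_assoc, hpq]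

/-- The homomorphism sending `a_i` to `q` for `i < s`, to `1` for `s ≤ i < t`, and to `p`
for the other `i`. -/
def chineseToBicyclic (n s t : ℕ) : ChineseMonoid n →* BicyclicMonoid :=
  PresentedMonoid.lift (fun i : Fin n => bicyclicStep s t i) (by
    rintro _ _ (⟨hij, hjk⟩ | ⟨hij, hjk⟩)
    · simpa using (isChineseFamily_bicyclicStep n s t _ _ _ hij hjk (Fin.is_lt _)).1
    · simpa using (isChineseFamily_bicyclicStep n s t _ _ _ hij hjk (Fin.is_lt _)).2)

theorem chineseToBicyclic_chineseGen {n i : ℕ} (s t : ℕ) (hi : i < n) :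
    chineseToBicyclic n s t (chineseGen n i) = bicyclicStep s t i := by
  simp [chineseGen, hi, chineseToBicyclic]

theorem chineseToBicyclic_surjective {n : ℕ} (hn : 2 ≤ n) :
    Function.Surjective (chineseToBicyclic n 1 1) := by
  rw [← MonoidHom.mrange_eq_top, eq_top_iff, ← PresentedMonoid.closure_range_of,
    Submonoid.closure_le]
  rintro _ ⟨i, rfl⟩
  fin_cases i
  · exact ⟨chineseGen n 1, by
      rw [chineseToBicyclic_chineseGen 1 1 (by omega)]; simp [bicyclicStep, bicyclicP]⟩
  · exact ⟨chineseGen n 0, by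
      rw [chineseToBicyclic_chineseGen 1 1 (by omega)]; simp [bicyclicStep, bicyclicQ]⟩

/-! ### The action on `ℕ` and its values on canonical forms -/

theorem Function.End.mul_apply {α : Type*} (f g : Function.End α) (x : α) :
    (f * g) x = f (g x) := rfl

theorem Function.End.one_apply {α : Type*} (x : α) : (1 : Function.End α) x = x := rfl

/-- The action of the generators `p` and `q` on `ℕ` by predecessor and successor. -/
def bicyclicActGen (i : Fin 2) : Function.End ℕ :=
  if i = 0 then Nat.pred else Nat.succ

/-- The action of the bicyclic monoid on `ℕ` by predecessor and successor. -/
def bicyclicAct : BicyclicMonoid →* Function.End ℕ :=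
  PresentedMonoid.lift bicyclicActGen (by
    intro _ _ h
    cases h
    rw [map_mul, map_one, FreeMonoid.lift_eval_of, FreeMonoid.lift_eval_of]
    rfl)

theorem bicyclicAct_bicyclicP (x : ℕ) : bicyclicAct bicyclicP x = x - 1 := rfl

theorem bicyclicAct_bicyclicQ (x : ℕ) : bicyclicAct bicyclicQ x = x + 1 := rfl

/-- The action of the Chinese monoid on `ℕ` through `chineseToBicyclic n s t`. -/
def chineseAct (n s t : ℕ) : ChineseMonoid n →* Function.End ℕ :=
  bicyclicAct.comp (chineseToBicyclic n s t)

theorem chineseAct_gen_of_lt {n s t i : ℕ} (hi : i < n) (hit : i < t) (x : ℕ) :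
    chineseAct n s t (chineseGen n i) x = x + if i < s then 1 else 0 := by
  rw [chineseAct, MonoidHom.comp_apply, chineseToBicyclic_chineseGen s t hi]
  unfold bicyclicStep
  split_ifs <;> simp [bicyclicAct_bicyclicQ, Function.End.one_apply]

theorem chineseAct_gen_of_ge {n s t i : ℕ} (hi : i < n) (hst : s ≤ t) (hit : t ≤ i) (x : ℕ) :
    chineseAct n s t (chineseGen n i) x = x - 1 := by
  rw [chineseAct, MonoidHom.comp_apply, chineseToBicyclic_chineseGen s t hi]
  unfold bicyclicStep
  rw [if_neg (by omega), if_neg (by omega)]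
  exact bicyclicAct_bicyclicP x

theorem pow_apply_of_forall_add {f : Function.End ℕ} {c : ℕ} (hf : ∀ x, f x = x + c) (e x : ℕ) :
    (f ^ e) x = x + e * c := by
  induction e generalizing x with
  | zero => simp [Function.End.one_apply]
  | succ e ih =>
    rw [pow_succ, Function.End.mul_apply, hf, ih]
    ring

theorem pow_apply_of_fixed {f : Function.End ℕ} {x : ℕ} (hf : f x = x) (e : ℕ) :
    (f ^ e) x = x := by
  induction e with
  | zero => simp [Function.End.one_apply]
  | succ e ih => rw [pow_succ, Function.End.mul_apply, hf, ih]

/-- The number of generators with index below `s` in the row `j` with exponents `k`. -/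
def rowWeight (s j : ℕ) (k : ℕ → ℕ) : ℕ :=
  ∑ i ∈ Finset.range j, k i * ((if i < s then 1 else 0) + if j < s then 1 else 0) +
    k j * if j < s then 1 else 0

theorem chineseAct_pairProd_of_lt {n s t m : ℕ} (hm : m < n) (hmt : m < t) (k : ℕ → ℕ) :
    ∀ {j : ℕ}, j ≤ m → ∀ x, chineseAct n s t (pairProd (chineseGen n) m k j) x =
      x + ∑ i ∈ Finset.range j, k i * ((if i < s then 1 else 0) + if m < s then 1 else 0)
  | 0, _, x => by simp [pairProd, Function.End.one_apply]
  | j + 1, hj, x => by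
    have hf : ∀ x, chineseAct n s t (chineseGen n m * chineseGen n j) x =
        x + ((if j < s then 1 else 0) + if m < s then 1 else 0) := fun x => by
      rw [map_mul, Function.End.mul_apply,
        chineseAct_gen_of_lt hm hmt, chineseAct_gen_of_lt (by omega) (by omega), add_assoc]
    rw [pairProd, map_mul, map_pow, Function.End.mul_apply,
      pow_apply_of_forall_add hf, chineseAct_pairProd_of_lt hm hmt k (by omega),
      Finset.sum_range_succ]
    ring

theorem chineseAct_canonicalRow_of_lt {n s t m : ℕ} (hm : m < n) (hmt : m < t) (k : ℕ → ℕ)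
    (x : ℕ) : chineseAct n s t (canonicalRow (chineseGen n) m k) x = x + rowWeight s m k := by
  rw [canonicalRow, map_mul, map_pow, Function.End.mul_apply,
    pow_apply_of_forall_add (chineseAct_gen_of_lt hm hmt),
    chineseAct_pairProd_of_lt hm hmt k le_rfl, rowWeight]
  ring

/-- In each pair the right factor acts first and takes `0` to `0` or `1`; the left factor acts as
`p` and returns it to `0`. -/
theorem chineseAct_pairProd_of_ge {n s t m : ℕ} (hm : m < n) (hst : s ≤ t) (hmt : t ≤ m)
    (k : ℕ → ℕ) : ∀ {j : ℕ}, j ≤ m →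
      chineseAct n s t (pairProd (chineseGen n) m k j) 0 = 0
  | 0, _ => by simp [pairProd, Function.End.one_apply]
  | j + 1, hj => by
    have hf : chineseAct n s t (chineseGen n m * chineseGen n j) 0 = 0 := by
      rw [map_mul, Function.End.mul_apply, chineseAct_gen_of_ge hm hst hmt]
      rcases lt_or_ge j t with h | h
      · rw [chineseAct_gen_of_lt (by omega) h]
        split_ifs <;> rfl
      · rw [chineseAct_gen_of_ge (by omega) hst h]
    rw [pairProd, map_mul, map_pow, Function.End.mul_apply,
      pow_apply_of_fixed hf, chineseAct_pairProd_of_ge hm hst hmt k (by omega)]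

theorem chineseAct_canonicalRow_of_ge {n s t m : ℕ} (hm : m < n) (hst : s ≤ t) (hmt : t ≤ m)
    (k : ℕ → ℕ) : chineseAct n s t (canonicalRow (chineseGen n) m k) 0 = 0 := by
  have h := chineseAct_gen_of_ge hm hst hmt 0
  rw [canonicalRow, map_mul, map_pow, Function.End.mul_apply,
    pow_apply_of_fixed h, chineseAct_pairProd_of_ge hm hst hmt k le_rfl]

theorem chineseAct_canonicalForm_of_le {n s t : ℕ} (k : ℕ → ℕ → ℕ) :
    ∀ {m : ℕ}, m ≤ n → m ≤ t → ∀ x, chineseAct n s t (canonicalForm (chineseGen n) k m) x =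
      x + ∑ j ∈ Finset.range m, rowWeight s j (k j)
  | 0, _, _, x => by simp [canonicalForm, Function.End.one_apply]
  | m + 1, hm, hmt, x => by
    rw [canonicalForm, map_mul, Function.End.mul_apply,
      chineseAct_canonicalRow_of_lt hm hmt,
      chineseAct_canonicalForm_of_le k (by omega) (by omega), Finset.sum_range_succ]
    ring

theorem chineseAct_canonicalForm {n s t : ℕ} (k : ℕ → ℕ → ℕ) (hst : s ≤ t) {m : ℕ}
    (htm : t ≤ m) : m ≤ n → chineseAct n s t (canonicalForm (chineseGen n) k m) 0 =
      ∑ j ∈ Finset.range t, rowWeight s j (k j) := by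
  induction m, htm using Nat.le_induction with
  | base =>
    intro hm
    rw [chineseAct_canonicalForm_of_le k hm le_rfl, zero_add]
  | succ m htm ih =>
    intro hm
    rw [canonicalForm, map_mul, Function.End.mul_apply,
      chineseAct_canonicalRow_of_ge hm hst htm, ih (by omega)]

/-! ### Recovering the exponents -/

theorem rowWeight_of_le {s j : ℕ} (hs : s ≤ j) (k : ℕ → ℕ) :
    rowWeight s j k = ∑ i ∈ Finset.range s, k i := by
  have h : ¬ j < s := by omega
  obtain ⟨d, rfl⟩ := Nat.exists_eq_add_of_le hs
  have h0 : ∑ i ∈ Finset.range d, k (s + i) * (if s + i < s then 1 else 0) = 0 :=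
    Finset.sum_eq_zero fun i _ => by simp
  simp only [rowWeight, h, if_false, add_zero, mul_zero]
  rw [Finset.sum_range_add, h0, add_zero]
  exact Finset.sum_congr rfl fun i hi => by simp [Finset.mem_range.1 hi]

/-- If all partial sums agree up to `m`, so do the terms. -/
theorem eq_of_sum_range_eq {f g : ℕ → ℕ} {m : ℕ}
    (h : ∀ s ≤ m, ∑ i ∈ Finset.range s, f i = ∑ i ∈ Finset.range s, g i) {i : ℕ} (hi : i < m) :
    f i = g i := by
  have h1 := h (i + 1) hi
  rw [Finset.sum_range_succ, Finset.sum_range_succ, h i hi.le] at h1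
  exact Nat.add_left_cancel h1

/-- Passing from `t = j` to `t = j + 1` isolates row `j`, whose weights for `s ≤ j` are the partial
sums of its off-diagonal exponents. Once these agree, `t = n` leaves the partial sums of the
diagonal. -/
theorem exponents_eq_of_sum_rowWeight_eq {n : ℕ} {k k' : ℕ → ℕ → ℕ}
    (h : ∀ s t, s ≤ t → t ≤ n → ∑ j ∈ Finset.range t, rowWeight s j (k j) =
      ∑ j ∈ Finset.range t, rowWeight s j (k' j)) :
    ∀ j < n, ∀ i ≤ j, k j i = k' j i := by
  have hoff : ∀ j < n, ∀ i < j, k j i = k' j i := by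
    intro j hj i hi
    refine eq_of_sum_range_eq (m := j) (fun s hs => ?_) hi
    have h1 := h s (j + 1) (by omega) hj
    rw [Finset.sum_range_succ, Finset.sum_range_succ, h s j hs hj.le] at h1
    rw [← rowWeight_of_le hs, ← rowWeight_of_le hs]
    exact Nat.add_left_cancel h1
  have hdiag : ∀ j < n, k j j = k' j j := by
    intro j hj
    refine eq_of_sum_range_eq (f := fun j => k j j) (g := fun j => k' j j) (m := n)
      (fun s hs => ?_) hj
    have h1 := h s n hs le_rfl
    simp only [rowWeight, Finset.sum_add_distrib] at h1
    have h2 : ∀ k : ℕ → ℕ → ℕ, ∑ j ∈ Finset.range n, (k j j * if j < s then 1 else 0) =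
        ∑ j ∈ Finset.range s, k j j := fun k => by
      obtain ⟨d, rfl⟩ := Nat.exists_eq_add_of_le hs
      have h0 : ∑ i ∈ Finset.range d, k (s + i) (s + i) * (if s + i < s then 1 else 0) = 0 :=
        Finset.sum_eq_zero fun i _ => by simp
      rw [Finset.sum_range_add, h0, add_zero]
      exact Finset.sum_congr rfl fun i hi => by simp [Finset.mem_range.1 hi]
    rw [h2, h2, Finset.sum_congr rfl fun j hj => Finset.sum_congr rfl fun i hi => by
      rw [hoff j (Finset.mem_range.1 hj) i (Finset.mem_range.1 hi)]] at h1
    exact Nat.add_left_cancel h1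
  intro j hj i hi
  rcases hi.lt_or_eq with hi | rfl
  · exact hoff j hj i hi
  · exact hdiag i hj

/-- The homomorphisms `chineseToBicyclic n s t` jointly separate the points of the Chinese
monoid. -/
theorem eq_of_forall_chineseToBicyclic_eq {n : ℕ} {x y : ChineseMonoid n}
    (h : ∀ s t, chineseToBicyclic n s t x = chineseToBicyclic n s t y) : x = y := by
  obtain ⟨k, rfl⟩ := exists_canonicalForm x
  obtain ⟨k', rfl⟩ := exists_canonicalForm y
  refine canonicalForm_congr (exponents_eq_of_sum_rowWeight_eq fun s t hst ht => ?_)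
  rw [← chineseAct_canonicalForm k hst ht le_rfl, ← chineseAct_canonicalForm k' hst ht le_rfl,
    chineseAct, MonoidHom.comp_apply, MonoidHom.comp_apply, h]

/-! ### Comparison of identities and varieties -/

section Transfer

variable {S S' : Type} [Monoid S] [Monoid S']

/-- Freeness lifts any evaluation along `f`, by choosing preimages of the letters. -/
theorem SatisfiesSemigroupIdentity.of_surjective {A : Type*} {u v : FreeSemigroup A}
    (h : SatisfiesSemigroupIdentity S u v) (f : S →* S') (hf : Function.Surjective f) :
    SatisfiesSemigroupIdentity S' u v := by
  intro φ
  have hφ : φ = (f : S →ₙ* S').comp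
      (FreeSemigroup.lift fun x => Function.surjInv hf (φ (FreeSemigroup.of x))) := by
    ext x
    simp [Function.surjInv_eq hf]
  rw [hφ, MulHom.comp_apply, MulHom.comp_apply, h]

theorem SatisfiesSemigroupIdentity.of_separating {ι A : Type*} {u v : FreeSemigroup A}
    (h : SatisfiesSemigroupIdentity S u v) (f : ι → S' →* S)
    (hf : ∀ x y, (∀ i, f i x = f i y) → x = y) : SatisfiesSemigroupIdentity S' u v :=
  fun φ => hf _ _ fun i => h ((f i : S' →ₙ* S).comp φ)

theorem SatisfiesMonoidIdentity.of_surjective {A : Type*} {u v : FreeMonoid A}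
    (h : SatisfiesMonoidIdentity S u v) (f : S →* S') (hf : Function.Surjective f) :
    SatisfiesMonoidIdentity S' u v := by
  intro φ
  have hφ : φ = f.comp
      (FreeMonoid.lift fun x => Function.surjInv hf (φ (FreeMonoid.of x))) := by
    ext x
    simp [Function.surjInv_eq hf]
  rw [hφ, MonoidHom.comp_apply, MonoidHom.comp_apply, h]

theorem SatisfiesMonoidIdentity.of_separating {ι A : Type*} {u v : FreeMonoid A}
    (h : SatisfiesMonoidIdentity S u v) (f : ι → S' →* S)
    (hf : ∀ x y, (∀ i, f i x = f i y) → x = y) : SatisfiesMonoidIdentity S' u v :=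
  fun φ => hf _ _ fun i => h ((f i).comp φ)

end Transfer

section Variety

variable {S S' : Type} [Semigroup S] [Semigroup S']

/-- A variety that contains all copies of the generator of another one contains that variety. -/
theorem InSemigroupVariety.of_generator
    (h : ∀ (T : Type u) [Semigroup T], S ≃* T → InSemigroupVariety S' T)
    {T : Type u} [Semigroup T] (hT : InSemigroupVariety S T) : InSemigroupVariety S' T := by
  induction hT with
  | self e => exact h _ e
  | image f hf _ ih => exact ih.image f hf
  | sub P _ ih => exact ih.sub P
  | prod T _ ih => exact InSemigroupVariety.prod T ih

theorem InSemigroupVariety.of_surjective (f : S →ₙ* S') (hf : Function.Surjective f)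
    {T : Type u} [Semigroup T] (e : S' ≃* T) : InSemigroupVariety S T := by
  -- `ULift` provides a copy of `S` in the universe of `T`.
  refine InSemigroupVariety.image (T := ULift.{u} S)
    ((e : S' →ₙ* T).comp (f.comp (MulEquiv.ulift : ULift.{u} S ≃* S).toMulHom)) ?_
    (.self MulEquiv.ulift.symm)
  exact e.surjective.comp (hf.comp MulEquiv.ulift.surjective)

/-- A separating family embeds `T` in a power of `S`, so `T` is isomorphic to a subsemigroup of that
power. -/
theorem InSemigroupVariety.of_separating {ι : Type} (f : ι → S' →ₙ* S)
    (hf : ∀ x y, (∀ i, f i x = f i y) → x = y)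
    {T : Type u} [Semigroup T] (e : S' ≃* T) : InSemigroupVariety S T := by
  let g : T →ₙ* (ULift.{u} ι → ULift.{u} S) :=
    { toFun := fun x i => ULift.up (f i.down (e.symm x))
      map_mul' := fun x y => by
        ext i
        simp }
  have hg : Function.Injective g := fun x y hxy =>
    e.symm.injective (hf _ _ fun i => congrArg ULift.down (congrFun hxy (ULift.up i)))
  let e' : T ≃* g.srange := MulEquiv.ofBijective g.srangeRestrict
    ⟨fun x y hxy => hg (congrArg Subtype.val hxy), g.srangeRestrict_surjective⟩
  exact InSemigroupVariety.image (e'.symm : g.srange →ₙ* T) e'.symm.surjective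
    (.sub g.srange (.prod _ fun _ => .self MulEquiv.ulift.symm))

end Variety

theorem mainTheorem3 (n : ℕ) (hn : 2 ≤ n) :
    (∀ (A : Type*) (u v : FreeSemigroup A),
      SatisfiesSemigroupIdentity (ChineseMonoid n) u v ↔
        SatisfiesSemigroupIdentity BicyclicMonoid u v) ∧
    (∀ (A : Type*) (u v : FreeMonoid A),
      SatisfiesMonoidIdentity (ChineseMonoid n) u v ↔
        SatisfiesMonoidIdentity BicyclicMonoid u v) ∧
    (∀ (T : Type*) [Semigroup T],
      InSemigroupVariety (ChineseMonoid n) T ↔ InSemigroupVariety BicyclicMonoid T) := by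
  have hsep : ∀ x y : ChineseMonoid n,
      (∀ i : ℕ × ℕ, chineseToBicyclic n i.1 i.2 x = chineseToBicyclic n i.1 i.2 y) → x = y :=
    fun x y h => eq_of_forall_chineseToBicyclic_eq fun s t => h (s, t)
  have hsurj := chineseToBicyclic_surjective hn
  refine ⟨fun A u v => ⟨fun h => h.of_surjective _ hsurj, fun h => h.of_separating _ hsep⟩,
    fun A u v => ⟨fun h => h.of_surjective _ hsurj, fun h => h.of_separating _ hsep⟩,
    fun T _ => ⟨fun h => h.of_generator fun T _ e => ?_, fun h => h.of_generator fun T _ e => ?_⟩⟩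
  · exact .of_separating
      (fun i : ℕ × ℕ => (chineseToBicyclic n i.1 i.2 : ChineseMonoid n →ₙ* BicyclicMonoid)) hsep e
  · exact .of_surjective (chineseToBicyclic n 1 1 : ChineseMonoid n →ₙ* BicyclicMonoid) hsurj e
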